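/- A rooted graph is a pair $(G,v)$ of a graph $G$ and a vertex $v$ of $G$, its root; $B_r(G,v)$ is the subgraph of $G$ induced on the vertices at distance at most $r$ from $v$, rooted at $v$, and $\cong$ denotes isomorphism preserving roots. Let $\mathcal G_*$ be the space of connected locally finite rooted graphs up to $\cong$, with the distance $d_{loc}(x,y)=2^{-\sup\{r\,:\,B_r(x)\cong B_r(y)\}}$ (equal to $0$ if the supremum is infinite) and its Borel $\sigma$-algebra. For a finite nonempty graph $G$ let $\mu_G$ be the law on $\mathcal G_*$ of the component of $v^*$ in $G$, rooted at $v^*$, where $v^*$ is a uniformly random vertex of $G$. Finite graphs $G_n$ converge to a random element $G^*$ of $\mathcal G_*$ in the local weak sense, written $G_n\to G^*$, if $\mu_{G_n}$ converges weakly to the law of $G^*$. All graphs are simple. For graphs $H$, $G$, let $\mathrm{emb}(H,G)$ be the number of injective homomorphisms from $H$ to $G$, and for a rooted graph $H'$ and a vertex $v$ of $G$ let $\mathrm{emb}'(H',G,v)$ be the number of those from $H'$ to $G$ that map the root of $H'$ to $v$. **Theorem.** Let $h\ge 2$ be an integer and let $(G_n)$ be a sequence of finite nonempty graphs with $|V(G_n)|\to\infty$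 and $G_n\to G^*$ in the local weak sense. Let $r^*$ be the root of $G^*$, let $d^*$ be the degree of $r^*$ in $G^*$, and assume $\mathbb E\,(d^*)^{h-1}<\infty$. Let $d_n$ be the degree of a uniformly random vertex of $G_n$. Then the following statements are equivalent: (i) $\mathbb E\, d_n^{h-1}\to\mathbb E\,(d^*)^{h-1}$ as $n\to\infty$; (ii) the sequence $(d_n^{h-1})_n$ is uniformly integrable, that is, $\lim_{a\to\infty}\sup_n\mathbb E\, d_n^{h-1}\mathbf 1_{\{d_n^{h-1}>a\}}=0$; (iii) for every connected graph $H$ on $h$ vertices and every rooted graph $H'$ obtained from $H$ by choosing a root, $\mathbb E\,\mathrm{emb}'(H',G^*,r^*)$ is finite and $$|V(G_n)|^{-1}\,\mathrm{emb}(H,G_n)\to\mathbb E\,\mathrm{emb}'(H',G^*,r^*)\quad\text{as } n\to\infty.$$ -/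

import Mathlib

open Filter Topology MeasureTheory
open scoped BigOperators

universe u

namespace LocalWeak

/-! ### Rooted graphs, balls and rooted isomorphism -/

/-- A rooted connected locally finite graph. -/
structure RootedGraph : Type (u + 1) where
  V : Type u
  graph : SimpleGraph V
  root : V
  connected : graph.Connected
  locallyFinite : ∀ v, (graph.neighborSet v).Finite

/-- Isomorphism of the rooted graphs `(G, v)` and `(H, w)`: a graph isomorphism that maps the
root to the root. -/
def RootedIso {V W : Type u} (G : SimpleGraph V) (v : V) (H : SimpleGraph W) (w : W) : Prop :=
  ∃ e : G ≃g H, e v = w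

/-- The vertices of `G` at distance at most `r` from `v`. -/
def ballSet {V : Type u} (G : SimpleGraph V) (v : V) (r : ℕ) : Set V :=
  {x | G.edist v x ≤ (r : ℕ∞)}

theorem mem_ballSet {V : Type u} {G : SimpleGraph V} {v : V} {r : ℕ} {x : V} :
    x ∈ ballSet G v r ↔ G.edist v x ≤ (r : ℕ∞) := Iff.rfl

theorem mem_ballSet_self {V : Type u} (G : SimpleGraph V) (v : V) (r : ℕ) :
    v ∈ ballSet G v r := by
  simp [ballSet]

/-- `B_r(G, v) ≅ B_r(H, w)`: the subgraphs induced on the balls of radius `r` around the roots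
are isomorphic as rooted graphs. -/
def BallIso {V W : Type u} (r : ℕ) (G : SimpleGraph V) (v : V) (H : SimpleGraph W) (w : W) :
    Prop :=
  RootedIso (G.induce (ballSet G v r)) ⟨v, mem_ballSet_self G v r⟩
    (H.induce (ballSet H w r)) ⟨w, mem_ballSet_self H w r⟩

theorem RootedIso.refl {V : Type u} (G : SimpleGraph V) (v : V) : RootedIso G v G v :=
  ⟨SimpleGraph.Iso.refl, rfl⟩

theorem RootedIso.symm {V W : Type u} {G : SimpleGraph V} {v : V} {H : SimpleGraph W} {w : W}
    (h : RootedIso G v H w) : RootedIso H w G v := by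
  obtain ⟨e, he⟩ := h
  exact ⟨e.symm, by rw [← he]; exact e.symm_apply_apply v⟩

theorem RootedIso.trans {V W X : Type u} {G : SimpleGraph V} {v : V} {H : SimpleGraph W} {w : W}
    {K : SimpleGraph X} {x : X} (h : RootedIso G v H w) (h' : RootedIso H w K x) :
    RootedIso G v K x := by
  obtain ⟨e, he⟩ := h
  obtain ⟨f, hf⟩ := h'
  exact ⟨e.trans f, by rw [← hf, ← he]; rfl⟩

theorem edist_map_le {V W : Type u} {G : SimpleGraph V} {H : SimpleGraph W} (f : G →g H)
    (x y : V) : H.edist (f x) (f y) ≤ G.edist x y := by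
  by_cases h : G.Reachable x y
  · obtain ⟨p, hp⟩ := h.exists_walk_length_eq_edist
    rw [← hp]
    simpa using SimpleGraph.edist_le (p.map f)
  · rw [SimpleGraph.edist_eq_top_of_not_reachable h]
    exact le_top

theorem edist_iso {V W : Type u} {G : SimpleGraph V} {H : SimpleGraph W} (e : G ≃g H)
    (x y : V) : H.edist (e x) (e y) = G.edist x y := by
  refine le_antisymm (edist_map_le e.toHom x y) ?_
  have h := edist_map_le e.symm.toHom (e x) (e y)
  have hx : e.symm.toHom (e x) = x := e.symm_apply_apply x
  have hy : e.symm.toHom (e y) = y := e.symm_apply_apply y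
  rwa [hx, hy] at h

theorem edist_ball {V : Type u} (G : SimpleGraph V) (v : V) (r : ℕ) (x : ballSet G v r) :
    (G.induce (ballSet G v r)).edist ⟨v, mem_ballSet_self G v r⟩ x = G.edist v x := by
  classical
  refine le_antisymm ?_ ?_
  · have hx : G.edist v x ≤ (r : ℕ∞) := x.2
    have hne : G.edist v x ≠ ⊤ := ne_top_of_le_ne_top (ENat.natCast_ne_top r) hx
    obtain ⟨p, hp⟩ := SimpleGraph.exists_walk_of_edist_ne_top hne
    have hs : ∀ y ∈ p.support, y ∈ ballSet G v r := by
      intro y hy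
      have h1 := SimpleGraph.edist_le (p.takeUntil y hy)
      have h2 : ((p.takeUntil y hy).length : ℕ∞) ≤ p.length := by
        exact_mod_cast p.length_takeUntil_le_length hy
      exact (h1.trans h2).trans (hp.le.trans hx)
    have h3 := SimpleGraph.edist_le (p.induce _ hs)
    have h4 : (p.induce _ hs).length = p.length := by
      have h5 := congrArg SimpleGraph.Walk.length (SimpleGraph.Walk.map_induce p hs)
      rwa [SimpleGraph.Walk.length_map] at h5
    rw [h4, hp] at h3
    exact h3
  · exact edist_map_le (SimpleGraph.Embedding.induce (ballSet G v r)).toHom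
      ⟨v, mem_ballSet_self G v r⟩ x

theorem RootedIso.ballIso {V W : Type u} {G : SimpleGraph V} {v : V} {H : SimpleGraph W} {w : W}
    (h : RootedIso G v H w) (r : ℕ) : BallIso r G v H w := by
  obtain ⟨e, rfl⟩ := h
  have hmem : ∀ x, x ∈ ballSet G v r ↔ e x ∈ ballSet H (e v) r := by
    intro x
    simp only [mem_ballSet, edist_iso]
  refine ⟨⟨e.toEquiv.subtypeEquiv hmem, ?_⟩, rfl⟩
  intro a b
  exact e.map_adj_iff

theorem BallIso.mono {V W : Type u} {G : SimpleGraph V} {v : V} {H : SimpleGraph W} {w : W}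
    {r s : ℕ} (hrs : r ≤ s) (h : BallIso s G v H w) : BallIso r G v H w := by
  obtain ⟨e, he⟩ := h
  have hsub : ∀ {X : Type u} (K : SimpleGraph X) (z : X), ballSet K z r ⊆ ballSet K z s := by
    intro X K z y hy
    exact le_trans (show K.edist z y ≤ (r : ℕ∞) from hy) (by exact_mod_cast hrs)
  have hd : ∀ x, H.edist w (e x) = G.edist v x := by
    intro x
    rw [← edist_ball G v s x, ← edist_ball H w s (e x), ← he, edist_iso]
  have hd' : ∀ y, G.edist v (e.symm y) = H.edist w y := by
    intro y
    rw [← hd, e.apply_symm_apply]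
  refine ⟨⟨⟨fun x => ⟨e ⟨x, hsub G v x.2⟩, ?_⟩, fun y => ⟨e.symm ⟨y, hsub H w y.2⟩, ?_⟩,
    ?_, ?_⟩, ?_⟩, ?_⟩
  · rw [mem_ballSet, hd]
    exact x.2
  · rw [mem_ballSet, hd']
    exact y.2
  · intro x
    simp
  · intro y
    simp
  · intro a b
    exact e.map_adj_iff (v := ⟨a, hsub G v a.2⟩) (w := ⟨b, hsub G v b.2⟩)
  · apply Subtype.ext
    have h1 : (e ⟨v, mem_ballSet_self G v s⟩).1 = w := by rw [he]
    exact h1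

/-! ### The space of rooted connected locally finite graphs with the local distance -/

instance rootedSetoid : Setoid RootedGraph.{u} where
  r G H := RootedIso G.graph G.root H.graph H.root
  iseqv := ⟨fun G => RootedIso.refl G.graph G.root, RootedIso.symm, RootedIso.trans⟩

/-- The set of rooted connected locally finite graphs up to rooted isomorphism. -/
def RootedSpace : Type (u + 1) := Quotient rootedSetoid.{u}

/-- The isomorphism class of a rooted graph. -/
def RootedSpace.mk (G : RootedGraph.{u}) : RootedSpace.{u} := Quotient.mk rootedSetoid G

/-- The set of radii `r` with `B_r(x) ≅ B_r(y)`. -/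
def ballAgree (x y : RootedSpace.{u}) : Set ℕ :=
  {r | Quotient.liftOn₂ x y
    (fun G H : RootedGraph.{u} => BallIso r G.graph G.root H.graph H.root) (by
      intro G₁ H₁ G₂ H₂ hG hH
      apply propext
      exact ⟨fun h => ((RootedIso.ballIso hG r).symm.trans h).trans (RootedIso.ballIso hH r),
        fun h => ((RootedIso.ballIso hG r).trans h).trans (RootedIso.ballIso hH r).symm⟩)}

open Classical in
/-- The local distance `2 ^ (- sup {r : B_r(x) ≅ B_r(y)})`, which is `0` if the supremum is
infinite. -/
noncomputable def dLoc (x y : RootedSpace.{u}) : ℝ :=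
  if BddAbove (ballAgree x y) then (2 : ℝ) ^ (-((sSup (ballAgree x y) : ℕ) : ℤ)) else 0

theorem ballAgree_self (x : RootedSpace.{u}) (r : ℕ) : r ∈ ballAgree x x := by
  induction x using Quotient.inductionOn with
  | h G => exact RootedIso.refl _ _

theorem ballAgree_symm {x y : RootedSpace.{u}} {r : ℕ} (h : r ∈ ballAgree x y) :
    r ∈ ballAgree y x := by
  induction x using Quotient.inductionOn with
  | h G =>
    induction y using Quotient.inductionOn with
    | h H => exact RootedIso.symm h

theorem ballAgree_trans {x y z : RootedSpace.{u}} {r : ℕ} (h : r ∈ ballAgree x y)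
    (h' : r ∈ ballAgree y z) : r ∈ ballAgree x z := by
  induction x using Quotient.inductionOn with
  | h G =>
    induction y using Quotient.inductionOn with
    | h H =>
      induction z using Quotient.inductionOn with
      | h K => exact RootedIso.trans h h'

theorem ballAgree_mono {x y : RootedSpace.{u}} {r s : ℕ} (hrs : r ≤ s)
    (h : s ∈ ballAgree x y) : r ∈ ballAgree x y := by
  induction x using Quotient.inductionOn with
  | h G =>
    induction y using Quotient.inductionOn with
    | h H => exact BallIso.mono hrs h

theorem ballAgree_zero (x y : RootedSpace.{u}) : 0 ∈ ballAgree x y := by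
  induction x using Quotient.inductionOn with
  | h G =>
    induction y using Quotient.inductionOn with
    | h H =>
      have hz : ∀ {X : Type u} (K : SimpleGraph X) (z : X) (a : ballSet K z 0), a.1 = z := by
        intro X K z a
        have h : K.edist z a ≤ ((0 : ℕ) : ℕ∞) := a.2
        rw [Nat.cast_zero, nonpos_iff_eq_zero, SimpleGraph.edist_eq_zero_iff] at h
        exact h.symm
      refine ⟨⟨⟨fun _ => ⟨H.root, mem_ballSet_self _ _ _⟩,
        fun _ => ⟨G.root, mem_ballSet_self _ _ _⟩, ?_, ?_⟩, ?_⟩, rfl⟩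
      · intro a
        exact Subtype.ext (hz _ _ a).symm
      · intro a
        exact Subtype.ext (hz _ _ a).symm
      · intro a b
        simp [hz _ _ a, hz _ _ b]

theorem dLoc_nonneg (x y : RootedSpace.{u}) : 0 ≤ dLoc x y := by
  unfold dLoc
  split_ifs <;> positivity

theorem dLoc_le_iff (x y : RootedSpace.{u}) (r : ℕ) :
    dLoc x y ≤ (2 : ℝ) ^ (-(r : ℤ)) ↔ r ∈ ballAgree x y := by
  unfold dLoc
  split_ifs with hb
  · rw [zpow_le_zpow_iff_right₀ (by norm_num : (1 : ℝ) < 2), neg_le_neg_iff, Nat.cast_le]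
    exact ⟨fun h => ballAgree_mono h (Nat.sSup_mem ⟨0, ballAgree_zero x y⟩ hb),
      fun h => le_csSup hb h⟩
  · refine ⟨fun _ => ?_, fun _ => by positivity⟩
    rw [not_bddAbove_iff] at hb
    obtain ⟨s, hs, hrs⟩ := hb r
    exact ballAgree_mono hrs.le hs

theorem dLoc_self (x : RootedSpace.{u}) : dLoc x x = 0 := by
  have h : ¬ BddAbove (ballAgree x x) :=
    not_bddAbove_iff.2 fun n => ⟨n + 1, ballAgree_self x _, n.lt_succ_self⟩
  simp [dLoc, h]

theorem dLoc_comm (x y : RootedSpace.{u}) : dLoc x y = dLoc y x := by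
  have h : ballAgree x y = ballAgree y x := Set.ext fun _ => ⟨ballAgree_symm, ballAgree_symm⟩
  unfold dLoc
  rw [h]

theorem dLoc_triangle (x y z : RootedSpace.{u}) : dLoc x z ≤ dLoc x y + dLoc y z := by
  by_contra! hlt
  have hb : BddAbove (ballAgree x z) := by
    by_contra hb
    have h0 : dLoc x z = 0 := by simp [dLoc, hb]
    linarith [dLoc_nonneg x y, dLoc_nonneg y z]
  have hxz : dLoc x z = (2 : ℝ) ^ (-((sSup (ballAgree x z) : ℕ) : ℤ)) := by simp [dLoc, hb]
  have key : ∀ a b : RootedSpace.{u}, dLoc a b < dLoc x z →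
      sSup (ballAgree x z) + 1 ∈ ballAgree a b := by
    intro a b hab
    unfold dLoc at hab
    split_ifs at hab with h
    · rw [zpow_lt_zpow_iff_right₀ (by norm_num : (1 : ℝ) < 2), neg_lt_neg_iff, Nat.cast_lt] at hab
      exact ballAgree_mono hab (Nat.sSup_mem ⟨0, ballAgree_zero a b⟩ h)
    · rw [not_bddAbove_iff] at h
      obtain ⟨s, hs, hrs⟩ := h (sSup (ballAgree x z) + 1)
      exact ballAgree_mono hrs.le hs
  have h1 := key x y (by linarith [dLoc_nonneg y z])
  have h2 := key y z (by linarith [dLoc_nonneg x y])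
  have h3 := le_csSup hb (ballAgree_trans h1 h2)
  omega

/-- The topology of the space of rooted graphs is the one of the distance `dLoc`. (The separation
axiom also holds, but only the topology and its Borel sets are used.) -/
noncomputable instance : PseudoMetricSpace RootedSpace.{u} where
  dist := dLoc
  dist_self := dLoc_self
  dist_comm := dLoc_comm
  dist_triangle := dLoc_triangle

noncomputable instance : MeasurableSpace RootedSpace.{u} := borel _

instance : BorelSpace RootedSpace.{u} := ⟨rfl⟩

/-! ### Degrees and numbers of embeddings -/

/-- The degree of `v` in a locally finite graph `G`. -/
noncomputable def deg {V : Type u} (G : SimpleGraph V) (v : V) : ℕ := (G.neighborSet v).ncard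

/-- The number of embeddings (injective homomorphisms) from `H` to `G`. -/
noncomputable def emb {W : Type} {V : Type u} (H : SimpleGraph W) (G : SimpleGraph V) : ℕ :=
  Nat.card (SimpleGraph.Copy H G)

/-- The number of embeddings (injective homomorphisms) from `H` to `G` that map `o` to `v`. It is
finite when `H` is finite and connected and `G` is locally finite. -/
noncomputable def embRooted {W : Type} {V : Type u} (H : SimpleGraph W) (o : W)
    (G : SimpleGraph V) (v : V) : ℕ :=
  Nat.card {f : SimpleGraph.Copy H G // f o = v}

theorem deg_iso {V W : Type u} {G : SimpleGraph V} {v : V} {H : SimpleGraph W} {w : W}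
    (h : RootedIso G v H w) : deg G v = deg H w := by
  obtain ⟨e, rfl⟩ := h
  exact Nat.card_congr (e.mapNeighborSet v)

theorem embRooted_iso {U : Type} (K : SimpleGraph U) (o : U) {V W : Type u} {G : SimpleGraph V}
    {v : V} {H : SimpleGraph W} {w : W} (h : RootedIso G v H w) :
    embRooted K o G v = embRooted K o H w := by
  obtain ⟨e, rfl⟩ := h
  refine Nat.card_congr ⟨fun f => ⟨e.toCopy.comp f.1, ?_⟩, fun f => ⟨e.symm.toCopy.comp f.1, ?_⟩,
    ?_, ?_⟩
  · rw [SimpleGraph.Copy.comp_apply, f.2]; rfl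
  · rw [SimpleGraph.Copy.comp_apply, f.2]; exact e.symm_apply_apply v
  · intro f
    apply Subtype.ext
    ext a
    exact e.symm_apply_apply _
  · intro f
    apply Subtype.ext
    ext a
    exact e.apply_symm_apply _

/-- The degree of the root, on the space of rooted graphs. -/
noncomputable def RootedSpace.rootDeg (x : RootedSpace.{u}) : ℕ :=
  Quotient.liftOn x (fun G : RootedGraph.{u} => deg G.graph G.root) fun _ _ h => deg_iso h

/-- The number of embeddings of `H` that map `o` to the root, on the space of rooted graphs. -/
noncomputable def RootedSpace.rootEmb {W : Type} (H : SimpleGraph W) (o : W)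
    (x : RootedSpace.{u}) : ℕ :=
  Quotient.liftOn x (fun G : RootedGraph.{u} => embRooted H o G.graph G.root)
    fun _ _ h => embRooted_iso H o h

/-! ### Local weak convergence and uniform integrability -/

/-- The component of the finite graph `G` that contains `v`, rooted at `v`. -/
def componentAt {V : Type u} [Fintype V] (G : SimpleGraph V) (v : V) : RootedGraph.{u} where
  V := G.connectedComponentMk v
  graph := (G.connectedComponentMk v).toSimpleGraph
  root := ⟨v, rfl⟩
  connected := SimpleGraph.ConnectedComponent.connected_toSimpleGraph _
  locallyFinite := fun _ => Set.toFinite _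

/-- The law of the rooted component of a uniformly random vertex of `G`. -/
noncomputable def localLaw {V : Type u} [Fintype V] [Nonempty V] (G : SimpleGraph V) :
    ProbabilityMeasure RootedSpace.{u} :=
  ⟨((PMF.uniformOfFintype V).map fun v => RootedSpace.mk (componentAt G v)).toMeasure,
    inferInstance⟩

/-- `G n` converges in the local weak sense to the random rooted graph with law `μ`: the laws of
the rooted components of uniformly random vertices converge weakly to `μ`. -/
def LocalWeakLimit {V : ℕ → Type u} [∀ n, Fintype (V n)] [∀ n, Nonempty (V n)]
    (G : ∀ n, SimpleGraph (V n)) (μ : ProbabilityMeasure RootedSpace.{u}) : Prop :=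
  Tendsto (fun n => localLaw (G n)) atTop (𝓝 μ)

/-- Uniform integrability of a sequence of random variables, where `X n` is a function of a
uniformly random element of the finite set `V n`:
`sup_n E |X n| 1_{|X n| > a}` tends to `0` as `a` tends to infinity. -/
def UniformlyIntegrable {V : ℕ → Type u} [∀ n, Fintype (V n)] (X : ∀ n, V n → ℝ) : Prop :=
  ∀ ε : ℝ, 0 < ε → ∃ a₀ : ℝ, ∀ a ≥ a₀, ∀ n, Finset.expect Finset.univ
    ({v | a < |X n v|}.indicator fun v => |X n v|) ≤ ε

end LocalWeak

/-! Local weak convergence means convergence of expectations of bounded continuous functions of the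
rooted component of a random vertex, and a function that depends only on a ball of fixed radius is
continuous. The equivalence of (i) and (ii) is then the classical fact that, for nonnegative
variables converging in law to an integrable limit, convergence of means is uniform integrability
(`SamplesTendTo.tendsto_of_uniformlyIntegrable`, `SamplesTendTo.uniformlyIntegrable_of_tendsto`).

For (ii) ⇒ (iii), embedding counts are unbounded, so only embeddings whose image has degrees at most
`M` are counted. A spanning tree bounds this truncated count by `M ^ (h - 1)`, and locality makes it
continuous. An embedding lost by the truncation is rerooted at a vertex whose image has maximal
degree `d > M`; the same tree bound gives at most `d ^ (h - 1)` of these per root and image vertex.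
Hence the total error is at most `h` times a tail sum of `d ^ (h - 1)`, which (ii) makes small after
averaging (`emb_le_sum_embBdd_add`).

For (iii) ⇒ (ii), the star with `h - 1` leaves suffices: rooted at its centre it has `d (d - 1) ⋯ (d
- h + 2)` embeddings, which is comparable to `d ^ (h - 1)` up to constants. -/

namespace LocalWeak

/-! ### Convergence of expectations along convergent samples -/

/-- The law of the random variable `φ n v`, where `v` is a uniformly random element of `V n`,
converges weakly to `μ`. -/
def SamplesTendTo {X : Type*} [TopologicalSpace X] [MeasurableSpace X] {V : ℕ → Type u}
    [∀ n, Fintype (V n)] (φ : ∀ n, V n → X) (μ : Measure X) : Prop :=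
  ∀ g : X → ℝ, Continuous g → (∃ C, ∀ x, |g x| ≤ C) →
    Tendsto (fun n => 𝔼 v, g (φ n v)) atTop (𝓝 (∫ x, g x ∂μ))

theorem continuous_min_const {X : Type*} [TopologicalSpace X] {f : X → ℝ}
    (hf : Continuous f) (M : ℝ) :
    Continuous fun x => min (f x) M := hf.min continuous_const

theorem bounded_min_const {X : Type*} {f : X → ℝ} (h0 : ∀ x, 0 ≤ f x) {M : ℝ}
    (hM : 0 ≤ M) : ∃ C, ∀ x, |min (f x) M| ≤ C :=
  ⟨M, fun x => by rw [abs_of_nonneg (le_min (h0 x) hM)]; exact min_le_right _ _⟩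

theorem tendsto_min_natCast (a : ℝ) : Tendsto (fun M : ℕ => min a (M : ℝ)) atTop (𝓝 a) := by
  refine tendsto_const_nhds.congr' ?_
  obtain ⟨N, hN⟩ := exists_nat_ge a
  filter_upwards [eventually_ge_atTop N] with M hM
  exact (min_eq_left (hN.trans (by exact_mod_cast hM))).symm

section Samples

variable {X : Type*} [TopologicalSpace X] [MeasurableSpace X] [OpensMeasurableSpace X]
  {V : ℕ → Type u} [∀ n, Fintype (V n)] {φ : ∀ n, V n → X} {μ : Measure X}

theorem integrable_of_continuous_of_bounded [IsFiniteMeasure μ] {g : X → ℝ} (hg : Continuous g)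
    (hb : ∃ C, ∀ x, |g x| ≤ C) : Integrable g μ := by
  obtain ⟨C, hC⟩ := hb
  exact Integrable.of_bound hg.measurable.aestronglyMeasurable C (ae_of_all _ hC)

/-- If `f` is a pointwise limit from below of bounded continuous functions that approximate it in
mean uniformly along the sample, then `f` is integrable and its expectations converge. -/
theorem SamplesTendTo.integrable_and_tendsto [IsFiniteMeasure μ] [∀ n, Nonempty (V n)]
    (hφ : SamplesTendTo φ μ) {f : X → ℝ}
    {g : ℕ → X → ℝ} (hgc : ∀ M, Continuous (g M)) (hgb : ∀ M, ∃ C, ∀ x, |g M x| ≤ C)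
    (hg0 : ∀ M x, 0 ≤ g M x) (hgf : ∀ M x, g M x ≤ f x)
    (hlim : ∀ x, Tendsto (fun M => g M x) atTop (𝓝 (f x)))
    (happ : ∀ ε : ℝ, 0 < ε → ∃ M₀, ∀ M ≥ M₀, ∀ n,
      𝔼 v, f (φ n v) ≤ 𝔼 v, g M (φ n v) + ε) :
    Integrable f μ ∧ Tendsto (fun n => 𝔼 v, f (φ n v)) atTop (𝓝 (∫ x, f x ∂μ)) := by
  have hgi : ∀ M, Integrable (g M) μ := fun M =>
    integrable_of_continuous_of_bounded (hgc M) (hgb M)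
  have hle : ∀ M n, 𝔼 v, g M (φ n v) ≤ 𝔼 v, f (φ n v) := fun M n =>
    Finset.expect_le_expect fun v _ => hgf M _
  -- The approximation with error 1 bounds all sample means of `f` by `C + 1`, where `C` bounds `g
  -- M₀`; the bound passes to the limit for each `g M`.
  obtain ⟨C, hC⟩ : ∃ C, ∀ M, ∫ x, g M x ∂μ ≤ C := by
    obtain ⟨M₀, hM₀⟩ := happ 1 one_pos
    obtain ⟨C, hC⟩ := hgb M₀
    refine ⟨C + 1, fun M => le_of_tendsto' (hφ _ (hgc M) (hgb M)) fun n => ?_⟩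
    refine (hle M n).trans ((hM₀ M₀ le_rfl n).trans (add_le_add_left ?_ 1))
    exact Finset.expect_le Finset.univ_nonempty fun v _ => (le_abs_self _).trans (hC _)
  have hfi : Integrable f μ := by
    refine ⟨aestronglyMeasurable_of_tendsto_ae _ (fun M => (hgi M).aestronglyMeasurable)
      (ae_of_all _ hlim), lt_of_le_of_lt ?_ (ENNReal.ofReal_lt_top (r := C))⟩
    -- Fatou's lemma turns the uniform bound on the integrals of `g M` into integrability of `f`.
    rw [lintegral_congr fun x => ((hlim x).enorm.liminf_eq).symm]
    refine (lintegral_liminf_le' fun M => (hgi M).aestronglyMeasurable.aemeasurable.enorm).trans ?_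
    refine liminf_le_of_le (by isBoundedDefault) fun b hb => ?_
    obtain ⟨M, hM⟩ := hb.exists
    refine hM.trans ?_
    rw [← ofReal_integral_norm_eq_lintegral_enorm (hgi M)]
    refine ENNReal.ofReal_le_ofReal (le_trans (le_of_eq ?_) (hC M))
    exact integral_congr_ae (ae_of_all _ fun x => by simp [abs_of_nonneg (hg0 M x)])
  refine ⟨hfi, ?_⟩
  have hdct : Tendsto (fun M => ∫ x, g M x ∂μ) atTop (𝓝 (∫ x, f x ∂μ)) :=
    tendsto_integral_of_dominated_convergence f (fun M => (hgi M).aestronglyMeasurable) hfi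
      (fun M => ae_of_all _ fun x => by
        rw [Real.norm_eq_abs, abs_of_nonneg (hg0 M x)]; exact hgf M x) (ae_of_all _ hlim)
  rw [Metric.tendsto_atTop]
  intro ε hε
  obtain ⟨M₁, hM₁⟩ := happ (ε / 4) (by positivity)
  obtain ⟨M₂, hM₂⟩ := Metric.tendsto_atTop.1 hdct (ε / 4) (by positivity)
  obtain ⟨N, hN⟩ := Metric.tendsto_atTop.1
    (hφ _ (hgc (max M₁ M₂)) (hgb _)) (ε / 4) (by positivity)
  refine ⟨N, fun n hn => ?_⟩
  have h1 := hM₁ _ (le_max_left M₁ M₂) n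
  have h2 := hM₂ _ (le_max_right M₁ M₂)
  have h3 := hN n hn
  have h4 := hle (max M₁ M₂) n
  rw [Real.dist_eq, abs_lt] at *
  constructor <;> linarith

/-- Truncating at `M` loses at most the tail: `f - min f M ≤ f 1_{f > M}`. -/
theorem SamplesTendTo.tendsto_of_uniformlyIntegrable [IsFiniteMeasure μ]
    [∀ n, Nonempty (V n)] (hφ : SamplesTendTo φ μ) {f : X → ℝ}
    (hf : Continuous f) (h0 : ∀ x, 0 ≤ f x) (hui : UniformlyIntegrable fun n v => f (φ n v)) :
    Tendsto (fun n => 𝔼 v, f (φ n v)) atTop (𝓝 (∫ x, f x ∂μ)) := by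
  refine (hφ.integrable_and_tendsto (g := fun M x => min (f x) (M : ℝ))
    (fun M => continuous_min_const hf _) (fun M => bounded_min_const h0 (Nat.cast_nonneg M))
    (fun M x => le_min (h0 x) (Nat.cast_nonneg M)) (fun M x => min_le_left _ _)
    (fun x => tendsto_min_natCast _) ?_).2
  intro ε hε
  obtain ⟨a₀, ha₀⟩ := hui ε hε
  obtain ⟨M₀, hM₀⟩ := exists_nat_ge a₀
  refine ⟨M₀, fun M hM n => ?_⟩
  have h1 := ha₀ M (hM₀.trans (by exact_mod_cast hM)) n
  refine le_trans ?_ (add_le_add_right h1 _)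
  rw [← Finset.expect_add_distrib]
  refine Finset.expect_le_expect fun v _ => ?_
  by_cases hv : (M : ℝ) < f (φ n v)
  · simp [Set.indicator, abs_of_nonneg (h0 _), hv, h0]
  · simp [Set.indicator, abs_of_nonneg (h0 _), hv, not_lt.1 hv]

/-- The means of `f` and of `min f M` both converge, so for large `n` the mean of `f - min f M` is
close to its limit, which is small for large `M`. This excess controls the tail beyond `2 * M`. The
finitely many remaining `n` involve only finitely many values of `f`. -/
theorem SamplesTendTo.uniformlyIntegrable_of_tendsto (hφ : SamplesTendTo φ μ) {f : X → ℝ}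
    (hf : Continuous f) (h0 : ∀ x, 0 ≤ f x) (hfi : Integrable f μ)
    (hlim : Tendsto (fun n => 𝔼 v, f (φ n v)) atTop (𝓝 (∫ x, f x ∂μ))) :
    UniformlyIntegrable fun n v => f (φ n v) := by
  intro ε hε
  have hdct : Tendsto (fun M : ℕ => ∫ x, min (f x) (M : ℝ) ∂μ) atTop (𝓝 (∫ x, f x ∂μ)) :=
    tendsto_integral_of_dominated_convergence f
      (fun M => (continuous_min_const hf _).measurable.aestronglyMeasurable) hfi
      (fun M => ae_of_all _ fun x => by
        rw [Real.norm_eq_abs, abs_of_nonneg (le_min (h0 x) (Nat.cast_nonneg M))]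
        exact min_le_left _ _) (ae_of_all _ fun x => tendsto_min_natCast _)
  obtain ⟨M, hM⟩ := Metric.tendsto_atTop.1 hdct (ε / 8) (by positivity)
  have hM := hM M le_rfl
  obtain ⟨N₁, hN₁⟩ := Metric.tendsto_atTop.1 hlim (ε / 8) (by positivity)
  obtain ⟨N₂, hN₂⟩ := Metric.tendsto_atTop.1 (hφ _ (continuous_min_const hf M)
    (bounded_min_const h0 (Nat.cast_nonneg M))) (ε / 8) (by positivity)
  obtain ⟨B, hB⟩ : ∃ B, ∀ n < max N₁ N₂, ∀ v, f (φ n v) ≤ B := by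
    refine ⟨∑ n ∈ Finset.range (max N₁ N₂), ∑ v, f (φ n v), fun n hn v => ?_⟩
    refine le_trans ?_ (Finset.single_le_sum (f := fun n => ∑ v, f (φ n v))
      (fun i _ => Finset.sum_nonneg fun v _ => h0 _) (Finset.mem_range.2 hn))
    exact Finset.single_le_sum (f := fun v => f (φ n v)) (fun v _ => h0 _) (Finset.mem_univ v)
  -- Where `f > a ≥ 2 * M`, the excess `f - M` is at least `f / 2`, which gives the factor 2 in
  -- `h3`; above `B` the small `n` have no tail at all.
  refine ⟨max B (2 * M), fun a ha n => ?_⟩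
  rcases lt_or_ge n (max N₁ N₂) with hn | hn
  · refine (Finset.expect_eq_zero fun v _ => ?_).trans_le hε.le
    have h1 := (hB n hn v).trans ((le_max_left B (2 * M)).trans ha)
    simp [Set.indicator, abs_of_nonneg (h0 _), h1]
  · have h1 := hN₁ n ((le_max_left _ _).trans hn)
    have h2 := hN₂ n ((le_max_right _ _).trans hn)
    have h3 : 𝔼 v, ({v | a < |f (φ n v)|}.indicator fun v => |f (φ n v)|) v ≤
        2 * (𝔼 v, f (φ n v) - 𝔼 v, min (f (φ n v)) (M : ℝ)) := by
      rw [← Finset.expect_sub_distrib, Finset.mul_expect]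
      refine Finset.expect_le_expect fun v _ => ?_
      have h4 := (le_max_right B (2 * M)).trans ha
      have h5 := h0 (φ n v)
      by_cases hv : a < f (φ n v)
      · have h6 : (M : ℝ) ≤ f (φ n v) := by
          have : (0 : ℝ) ≤ M := Nat.cast_nonneg M
          linarith
        simp only [Set.indicator, abs_of_nonneg (h0 _), Set.mem_ofPred_eq, hv, if_true,
          min_eq_right h6]
        linarith
      · simp [Set.indicator, abs_of_nonneg (h0 _), hv]
    refine h3.trans ?_
    rw [Real.dist_eq, abs_lt] at hM h1 h2
    linarith

end Samples

/-! ### Local weak convergence in terms of samples -/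

theorem integral_localLaw {V : Type u} [Fintype V] [Nonempty V] (G : SimpleGraph V)
    {g : RootedSpace.{u} → ℝ} (hg : Continuous g) :
    ∫ x, g x ∂(localLaw G : Measure RootedSpace.{u}) =
      𝔼 v, g (RootedSpace.mk (componentAt G v)) := by
  let _ : MeasurableSpace V := ⊤
  have h1 : (localLaw G : Measure RootedSpace.{u}) =
      (PMF.uniformOfFintype V).toMeasure.map fun v => RootedSpace.mk (componentAt G v) := by
    ext s hs
    rw [Measure.map_apply (measurable_from_top) hs]
    exact PMF.toMeasure_map_apply _ _ s measurable_from_top hs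
  rw [h1, integral_map measurable_from_top.aemeasurable hg.measurable.aestronglyMeasurable,
    PMF.integral_eq_sum, Fintype.expect_eq_sum_div_card, Finset.sum_div]
  refine Finset.sum_congr rfl fun v _ => ?_
  simp [div_eq_inv_mul]

theorem LocalWeakLimit.samplesTendTo {V : ℕ → Type u} [∀ n, Fintype (V n)]
    [∀ n, Nonempty (V n)] {G : ∀ n, SimpleGraph (V n)}
    {μ : ProbabilityMeasure RootedSpace.{u}} (h : LocalWeakLimit G μ) :
    SamplesTendTo (fun n v => RootedSpace.mk (componentAt (G n) v))
      (μ : Measure RootedSpace.{u}) := by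
  rintro g hg ⟨C, hC⟩
  have h1 := ProbabilityMeasure.tendsto_iff_forall_integral_tendsto.1 h
    (BoundedContinuousFunction.ofNormedAddCommGroup g hg C hC)
  refine h1.congr fun n => ?_
  exact integral_localLaw (G n) hg

/-- Such a function is locally constant: points at distance less than `2 ^ (-r)` have isomorphic
balls of radius `r`. -/
theorem continuous_of_ballAgree {g : RootedSpace.{u} → ℝ} (r : ℕ)
    (hg : ∀ x y, r ∈ ballAgree x y → g x = g y) : Continuous g := by
  refine (IsLocallyConstant.iff_exists_open g).2 (fun x => ?_) |>.continuous
  refine ⟨Metric.ball x ((2 : ℝ) ^ (-(r : ℤ))), Metric.isOpen_ball,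
    Metric.mem_ball_self (by positivity), fun y hy => ?_⟩
  exact hg y x ((dLoc_le_iff y x r).1 (le_of_lt (Metric.mem_ball.1 hy)))

/-! ### Embeddings whose images have bounded degrees -/

section Embeddings

variable {W : Type} {V : Type u}

/-- The embeddings of `H` in `G`, as functions, that map `o` to `v` and all of whose values have
degree at most `M`. -/
def embBddSet (H : SimpleGraph W) (o : W) (G : SimpleGraph V) (v : V) (M : ℕ) : Set (W → V) :=
  {f | Function.Injective f ∧ (∀ a b, H.Adj a b → G.Adj (f a) (f b)) ∧ f o = v ∧
    ∀ w, deg G (f w) ≤ M}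

/-- The number of embeddings of `H` in `G` that map `o` to `v` and all of whose values have degree
at most `M`. -/
noncomputable def embBdd (H : SimpleGraph W) (o : W) (G : SimpleGraph V) (v : V) (M : ℕ) : ℕ :=
  (embBddSet H o G v M).ncard

theorem mem_embBddSet {H : SimpleGraph W} {o : W} {G : SimpleGraph V} {v : V} {M : ℕ}
    {f : W → V} : f ∈ embBddSet H o G v M ↔ Function.Injective f ∧
      (∀ a b, H.Adj a b → G.Adj (f a) (f b)) ∧ f o = v ∧ ∀ w, deg G (f w) ≤ M := Iff.rfl

/-- Provides the parent of `w` in a breadth-first spanning tree rooted at `o`. -/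
theorem exists_adj_dist_lt {H : SimpleGraph W} (hH : H.Connected) {o w : W} (hw : w ≠ o) :
    ∃ p, H.Adj p w ∧ H.dist o p < H.dist o w := by
  obtain ⟨q, hq⟩ := hH.exists_walk_length_eq_dist w o
  cases q with
  | nil => exact absurd rfl hw
  | cons hadj q =>
    refine ⟨_, hadj.symm, ?_⟩
    have h1 := SimpleGraph.dist_le q
    rw [SimpleGraph.Walk.length_cons] at hq
    rw [SimpleGraph.dist_comm, SimpleGraph.dist_comm (u := o)]
    omega

theorem exists_injOn_neighborSet {G : SimpleGraph V} (hG : ∀ v, (G.neighborSet v).Finite) :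
    ∃ ι : V → V → ℕ, ∀ x, Set.InjOn (ι x) (G.neighborSet x) ∧
      ∀ y ∈ G.neighborSet x, ι x y < deg G x := by
  classical
  have h : ∀ x, ∃ i : V → ℕ, Set.InjOn i (G.neighborSet x) ∧
      ∀ y ∈ G.neighborSet x, i y < deg G x := by
    intro x
    have := (hG x).to_subtype
    have e : G.neighborSet x ≃ Fin (deg G x) := Finite.equivFin _
    refine ⟨fun y => if hy : y ∈ G.neighborSet x then e ⟨y, hy⟩ else 0, ?_, ?_⟩
    · intro y hy z hz hyz
      simpa [hy, hz, Fin.val_inj, -SimpleGraph.mem_neighborSet] using hyz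
    · intro y hy
      simp [hy, -SimpleGraph.mem_neighborSet]
  choose ι hι using h
  exact ⟨ι, hι⟩

/-- An embedding is encoded by recording, for each `w ≠ o`, the label of `f w` among the neighbours
of the image of the parent of `w`. Labels are below `M`, which leaves `M ^ (|W| - 1)` codes.
Decoding goes outwards from the root, by induction on the distance to `o`. -/
theorem embBddSet_finite_and_embBdd_le [Fintype W] {H : SimpleGraph W} (hH : H.Connected) (o : W)
    {G : SimpleGraph V} (hG : ∀ v, (G.neighborSet v).Finite) (v : V) (M : ℕ) :
    (embBddSet H o G v M).Finite ∧ embBdd H o G v M ≤ M ^ (Fintype.card W - 1) := by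
  classical
  obtain ⟨ι, hι⟩ := exists_injOn_neighborSet hG
  have hp : ∀ w : {w // w ≠ o}, ∃ p, H.Adj p w ∧ H.dist o p < H.dist o w :=
    fun w => exists_adj_dist_lt hH w.2
  choose p hadj hdist using hp
  let Φ : (W → V) → ({w // w ≠ o} → ℕ) := fun f w => ι (f (p w)) (f w)
  let T : Finset ({w // w ≠ o} → ℕ) := Fintype.piFinset fun _ => Finset.range M
  have hmaps : ∀ f ∈ embBddSet H o G v M, Φ f ∈ (T : Set _) := by
    rintro f ⟨-, hf, -, hM⟩
    simp only [T, Finset.mem_coe, Fintype.mem_piFinset, Finset.mem_range]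
    exact fun w => ((hι _).2 _ (hf _ _ (hadj w))).trans_le (hM _)
  have hinj : Set.InjOn Φ (embBddSet H o G v M) := by
    rintro f ⟨-, hf, hfo, -⟩ g ⟨-, hg, hgo, -⟩ hfg
    have key : ∀ n w, H.dist o w = n → f w = g w := by
      intro n
      induction n using Nat.strong_induction_on with
      | _ n ih =>
        intro w hw
        by_cases hwo : w = o
        · rw [hwo, hfo, hgo]
        · have h1 := ih _ (hw ▸ hdist ⟨w, hwo⟩) _ rfl
          have h2 : ι (f (p ⟨w, hwo⟩)) (f w) = ι (g (p ⟨w, hwo⟩)) (g w) :=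
            congrFun hfg ⟨w, hwo⟩
          rw [h1] at h2
          refine (hι _).1 ?_ ?_ h2
          · rw [← h1]; exact hf _ _ (hadj ⟨w, hwo⟩)
          · exact hg _ _ (hadj ⟨w, hwo⟩)
    exact funext fun w => key _ w rfl
  refine ⟨Set.Finite.of_injOn hmaps hinj T.finite_toSet, ?_⟩
  refine (Set.ncard_le_ncard_of_injOn Φ hmaps hinj T.finite_toSet).trans (le_of_eq ?_)
  rw [Set.ncard_coe_finset]
  simp [T, Fintype.card_subtype_compl]

/-- A path in `H` has fewer than `|W|` edges. The spare 1 is what keeps the neighbours of image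
vertices, and so their degrees, inside the ball of radius `|W|`. -/
theorem edist_apply_lt_card [Fintype W] {H : SimpleGraph W} (hH : H.Connected) {G : SimpleGraph V}
    {f : W → V} (hf : ∀ a b, H.Adj a b → G.Adj (f a) (f b)) (o w : W) :
    G.edist (f o) (f w) + 1 ≤ (Fintype.card W : ℕ∞) := by
  classical
  obtain ⟨q, hq⟩ := (hH.preconnected o w).exists_isPath
  let F : H →g G := ⟨f, fun {a b} => hf a b⟩
  have h1 : G.edist (f o) (f w) ≤ (q.length : ℕ∞) := by
    have h := SimpleGraph.edist_le (q.map F)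
    rwa [SimpleGraph.Walk.length_map] at h
  refine (add_le_add_left h1 1).trans ?_
  exact_mod_cast hq.length_lt

theorem deg_induce {G : SimpleGraph V} {S : Set V} (x : S) (hx : G.neighborSet x ⊆ S) :
    deg (G.induce S) x = deg G x := by
  have h : Subtype.val '' (G.induce S).neighborSet x = G.neighborSet x := by
    ext y
    constructor
    · rintro ⟨z, hz, rfl⟩
      exact hz
    · intro hy
      exact ⟨⟨y, hx hy⟩, hy, rfl⟩
  unfold deg
  rw [← h, Set.ncard_image_of_injective _ Subtype.val_injective]

theorem neighborSet_subset_ballSet {G : SimpleGraph V} {v x : V} {r : ℕ}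
    (h : G.edist v x + 1 ≤ (r : ℕ∞)) : G.neighborSet x ⊆ ballSet G v r := by
  intro y hy
  refine SimpleGraph.edist_triangle.trans ((add_le_add_right ?_ _).trans h)
  exact (SimpleGraph.edist_eq_one_iff_adj.2 hy).le

/-- This is the locality of the truncated count: the image and all its neighbours lie in `S`, so
both the embeddings and the degree condition are the same in the induced graph. -/
theorem embBdd_induce [Fintype W] {H : SimpleGraph W} (hH : H.Connected) (o : W)
    {G : SimpleGraph V} {S : Set V} (v : S) (hS : ballSet G v (Fintype.card W) ⊆ S) (M : ℕ) :
    embBdd H o (G.induce S) v M = embBdd H o G v M := by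
  have hcomp : Function.Injective fun f : W → S => fun w => (f w : V) :=
    fun f g hfg => funext fun w => Subtype.ext (congrFun hfg w)
  have hnb : ∀ {f : W → V}, (∀ a b, H.Adj a b → G.Adj (f a) (f b)) → f o = v → ∀ w,
      G.neighborSet (f w) ⊆ S := by
    intro f hf hfo w
    refine (neighborSet_subset_ballSet ?_).trans hS
    rw [← hfo]
    exact edist_apply_lt_card hH hf o w
  unfold embBdd
  rw [← Set.ncard_image_of_injective _ hcomp]
  congr 1
  ext f
  simp only [Set.mem_image, mem_embBddSet]
  constructor
  · rintro ⟨f, ⟨hinj, hf, hfo, hM⟩, rfl⟩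
    have hfo' : (f o : V) = v := congrArg Subtype.val hfo
    refine ⟨fun a b hab => hinj (Subtype.ext hab), hf, hfo', fun w => ?_⟩
    rw [← deg_induce (f w) (hnb (f := fun w => (f w : V)) hf hfo' w)]
    exact hM w
  · rintro ⟨hinj, hf, hfo, hM⟩
    have hmem : ∀ w, f w ∈ S := fun w => hS <| by
      have h1 := edist_apply_lt_card hH hf o w
      rw [hfo] at h1
      exact le_self_add.trans h1
    refine ⟨fun w => ⟨f w, hmem w⟩, ⟨fun a b hab => hinj (congrArg Subtype.val hab), hf,
      Subtype.ext hfo, fun w => ?_⟩, rfl⟩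
    rw [deg_induce ⟨f w, hmem w⟩ (hnb hf hfo w)]
    exact hM w

theorem embBdd_iso (H : SimpleGraph W) (o : W) {V' : Type u} {G : SimpleGraph V} {v : V}
    {G' : SimpleGraph V'} {v' : V'} (h : RootedIso G v G' v') (M : ℕ) :
    embBdd H o G v M = embBdd H o G' v' M := by
  obtain ⟨e, rfl⟩ := h
  have hcomp : Function.Injective fun f : W → V => fun w => e (f w) :=
    fun f g hfg => funext fun w => e.injective (congrFun hfg w)
  have hdeg : ∀ x, deg G' (e x) = deg G x := fun x => (deg_iso ⟨e, rfl⟩).symm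
  unfold embBdd
  rw [← Set.ncard_image_of_injective _ hcomp]
  congr 1
  ext f
  simp only [Set.mem_image, mem_embBddSet]
  constructor
  · rintro ⟨f, ⟨hinj, hf, rfl, hM⟩, rfl⟩
    exact ⟨fun a b hab => hinj (e.injective hab), fun a b hab => e.map_adj_iff.2 (hf a b hab), rfl,
      fun w => (hdeg _).trans_le (hM w)⟩
  · rintro ⟨hinj, hf, hfo, hM⟩
    refine ⟨fun w => e.symm (f w), ⟨fun a b hab => hinj (e.symm.injective hab),
      fun a b hab => e.symm.map_adj_iff.2 (hf a b hab), ?_, fun w => ?_⟩, ?_⟩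
    · exact (congrArg e.symm hfo).trans (e.symm_apply_apply v)
    · rw [← hdeg, e.apply_symm_apply]
      exact hM w
    · funext w
      exact e.apply_symm_apply _

theorem embBdd_congr_of_ballIso [Fintype W] {H : SimpleGraph W} (hH : H.Connected) (o : W)
    {V' : Type u} {G : SimpleGraph V} {v : V} {G' : SimpleGraph V'} {v' : V'}
    (h : BallIso (Fintype.card W) G v G' v') (M : ℕ) :
    embBdd H o G v M = embBdd H o G' v' M := by
  rw [← embBdd_induce hH o ⟨v, mem_ballSet_self G v (Fintype.card W)⟩ subset_rfl M,
    ← embBdd_induce hH o ⟨v', mem_ballSet_self G' v' (Fintype.card W)⟩ subset_rfl M]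
  exact embBdd_iso H o h M

theorem deg_congr_of_ballIso {V' : Type u} {G : SimpleGraph V} {v : V} {G' : SimpleGraph V'}
    {v' : V'} (h : BallIso 1 G v G' v') : deg G v = deg G' v' := by
  have hsub : ∀ {Y : Type u} (K : SimpleGraph Y) (y : Y), K.neighborSet y ⊆ ballSet K y 1 :=
    fun K y => neighborSet_subset_ballSet (by simp)
  rw [← deg_induce ⟨v, mem_ballSet_self G v 1⟩ (hsub G v),
    ← deg_induce ⟨v', mem_ballSet_self G' v' 1⟩ (hsub G' v')]
  exact deg_iso h

theorem ballSet_finite {G : SimpleGraph V} (hG : ∀ v, (G.neighborSet v).Finite) (v : V) (r : ℕ) :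
    (ballSet G v r).Finite := by
  induction r with
  | zero =>
    refine (Set.finite_singleton v).subset fun x hx => ?_
    have h : G.edist v x ≤ ((0 : ℕ) : ℕ∞) := hx
    rw [Nat.cast_zero, nonpos_iff_eq_zero, SimpleGraph.edist_eq_zero_iff] at h
    exact h.symm
  | succ r ih =>
    refine ((Set.finite_singleton v).union (ih.biUnion fun x _ => hG x)).subset fun x hx => ?_
    have hx : G.edist v x ≤ ((r + 1 : ℕ) : ℕ∞) := hx
    obtain ⟨q, hq⟩ := SimpleGraph.exists_walk_of_edist_ne_top
      (ne_top_of_le_ne_top (ENat.natCast_ne_top _) hx)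
    rw [← hq] at hx
    have hx : q.length ≤ r + 1 := by exact_mod_cast hx
    induction q using SimpleGraph.Walk.concatRec with
    | Hnil => exact Or.inl rfl
    | Hconcat q hadj _ =>
      rw [SimpleGraph.Walk.length_concat] at hx
      refine Or.inr (Set.mem_biUnion (?_ : _ ∈ ballSet G _ r) hadj)
      refine (SimpleGraph.edist_le q).trans ?_
      exact_mod_cast Nat.le_of_succ_le_succ hx

/-- Rooted embeddings as functions. -/
def embSetEquiv (H : SimpleGraph W) (o : W) (G : SimpleGraph V) (v : V) :
    {f : SimpleGraph.Copy H G // f o = v} ≃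
      {f : W → V | Function.Injective f ∧ (∀ a b, H.Adj a b → G.Adj (f a) (f b)) ∧ f o = v} where
  toFun f := ⟨f.1, f.1.injective, fun _ _ hab => f.1.toHom.map_adj hab, f.2⟩
  invFun f := ⟨⟨⟨f.1, fun {a b} => f.2.2.1 a b⟩, f.2.1⟩, f.2.2.2⟩
  left_inv _ := rfl
  right_inv _ := rfl

theorem embRooted_eq_ncard (H : SimpleGraph W) (o : W) (G : SimpleGraph V) (v : V) :
    embRooted H o G v = {f : W → V | Function.Injective f ∧
      (∀ a b, H.Adj a b → G.Adj (f a) (f b)) ∧ f o = v}.ncard :=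
  Nat.card_congr (embSetEquiv H o G v)

/-- All images lie in one finite ball, on which degrees are bounded. -/
theorem exists_embBddSet_eq [Fintype W] {H : SimpleGraph W} (hH : H.Connected) (o : W)
    {G : SimpleGraph V} (hG : ∀ v, (G.neighborSet v).Finite) (v : V) :
    ∃ M₀, ∀ M ≥ M₀, embBddSet H o G v M = {f : W → V | Function.Injective f ∧
      (∀ a b, H.Adj a b → G.Adj (f a) (f b)) ∧ f o = v} := by
  obtain ⟨M₀, hM₀⟩ := ((ballSet_finite hG v (Fintype.card W)).image (deg G)).bddAbove
  refine ⟨M₀, fun M hM => Set.ext fun f => ⟨fun ⟨h1, h2, h3, _⟩ => ⟨h1, h2, h3⟩,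
    fun ⟨h1, h2, h3⟩ => ⟨h1, h2, h3, fun w => ?_⟩⟩⟩
  refine le_trans (hM₀ ⟨f w, ?_, rfl⟩) hM
  have h := edist_apply_lt_card hH h2 o w
  rw [h3] at h
  exact le_self_add.trans h

theorem embBdd_eq_embRooted [Fintype W] {H : SimpleGraph W} (hH : H.Connected) (o : W)
    {G : SimpleGraph V} (hG : ∀ v, (G.neighborSet v).Finite) (v : V) :
    ∃ M₀, ∀ M ≥ M₀, embBdd H o G v M = embRooted H o G v := by
  obtain ⟨M₀, hM₀⟩ := exists_embBddSet_eq hH o hG v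
  exact ⟨M₀, fun M hM => by rw [embRooted_eq_ncard, embBdd, hM₀ M hM]⟩

theorem embBdd_mono [Fintype W] {H : SimpleGraph W} (hH : H.Connected) (o : W)
    {G : SimpleGraph V} (hG : ∀ v, (G.neighborSet v).Finite) (v : V) {M N : ℕ} (hMN : M ≤ N) :
    embBdd H o G v M ≤ embBdd H o G v N :=
  Set.ncard_le_ncard (fun _ ⟨h1, h2, h3, h4⟩ => ⟨h1, h2, h3, fun w => (h4 w).trans hMN⟩)
    (embBddSet_finite_and_embBdd_le hH o hG v N).1

theorem embBdd_le_embRooted [Fintype W] {H : SimpleGraph W} (hH : H.Connected) (o : W)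
    {G : SimpleGraph V} (hG : ∀ v, (G.neighborSet v).Finite) (v : V) (M : ℕ) :
    embBdd H o G v M ≤ embRooted H o G v := by
  obtain ⟨M₀, hM₀⟩ := embBdd_eq_embRooted hH o hG v
  rw [← hM₀ (max M M₀) (le_max_right _ _)]
  exact embBdd_mono hH o hG v (le_max_left _ _)

/-- In a locally finite graph the embeddings of the star with centre at `v` correspond to the
tuples of distinct neighbours of `v`. -/
theorem embRooted_starGraph {G : SimpleGraph V} (v : V) (hG : (G.neighborSet v).Finite) (k : ℕ) :
    embRooted (SimpleGraph.starGraph (0 : Fin (k + 1))) 0 G v = (deg G v).descFactorial k := by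
  classical
  have := hG.fintype
  have e : {f : SimpleGraph.Copy (SimpleGraph.starGraph (0 : Fin (k + 1))) G // f 0 = v} ≃
      (Fin k ↪ G.neighborSet v) :=
    { toFun := fun f => ⟨fun i => ⟨f.1 i.succ, by
          rw [SimpleGraph.mem_neighborSet]
          conv_lhs => rw [← f.2]
          exact f.1.toHom.map_adj (by simp [Fin.succ_ne_zero, eq_comm])⟩,
        fun i j hij => Fin.succ_injective _ (f.1.injective (congrArg Subtype.val hij))⟩
      invFun := fun g => ⟨⟨⟨Fin.cons v fun i => (g i : V), by
          intro a b hab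
          induction a using Fin.cases with
          | zero =>
            induction b using Fin.cases with
            | zero => simp at hab
            | succ j => exact (g j).2
          | succ i =>
            induction b using Fin.cases with
            | zero => exact (SimpleGraph.Adj.symm (g i).2)
            | succ j => simp [Fin.succ_ne_zero] at hab⟩, by
          refine Fin.cons_injective_iff.2 ⟨?_, fun i j hij => g.injective (Subtype.ext hij)⟩
          rintro ⟨i, hi⟩
          have h : G.Adj v (g i) := (g i).2
          exact h.ne hi.symm⟩, rfl⟩
      left_inv := by
        intro f
        apply Subtype.ext
        ext i
        induction i using Fin.cases with
        | zero => exact f.2.symm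
        | succ i => rfl
      right_inv := by
        intro g
        ext i
        rfl }
  unfold embRooted deg
  rw [Nat.card_congr e, Nat.card_eq_fintype_card, Fintype.card_embedding_eq, Fintype.card_fin,
    ← Nat.card_coe_set_eq, Nat.card_eq_fintype_card]

/-! ### Sums over the vertices of a finite graph -/

theorem emb_eq_sum [Fintype V] [Fintype W] (H : SimpleGraph W) (o : W) (G : SimpleGraph V) :
    emb H G = ∑ v, embRooted H o G v := by
  classical
  have : Finite (SimpleGraph.Copy H G) := Finite.of_injective (fun f => (f : W → V))
    DFunLike.coe_injective
  unfold emb embRooted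
  rw [← Nat.card_sigma]
  exact Nat.card_congr (Equiv.sigmaFiberEquiv fun f : SimpleGraph.Copy H G => f o).symm

/-- Embeddings with a value of large degree are controlled by rooting them at a vertex whose image
has maximal degree. -/
theorem emb_le_sum_embBdd_add [Fintype V] [Fintype W] {H : SimpleGraph W} (hH : H.Connected)
    (o : W) (G : SimpleGraph V) (M : ℕ) :
    (emb H G : ℝ) ≤ ∑ v, (embBdd H o G v M : ℝ) + Fintype.card W *
      ∑ v, {v | M < deg G v}.indicator (fun v => (deg G v : ℝ) ^ (Fintype.card W - 1)) v := by
  classical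
  have hfin : ∀ v, (G.neighborSet v).Finite := fun v => Set.toFinite _
  let A : Set (W → V) := {f | Function.Injective f ∧ ∀ a b, H.Adj a b → G.Adj (f a) (f b)}
  have hemb : emb H G = A.ncard := Nat.card_congr
    { toFun := fun f => ⟨f, f.injective, fun _ _ hab => f.toHom.map_adj hab⟩
      invFun := fun f => ⟨⟨f.1, fun {a b} => f.2.2 a b⟩, f.2.1⟩
      left_inv := fun _ => rfl
      right_inv := fun _ => rfl }
  -- Either all image degrees are at most `M`, or some vertex `w` of `H` has an image of maximal
  -- degree, which exceeds `M`; rooted at `w`, the embedding satisfies the degree bound given by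
  -- that maximum.
  have hsub : A ⊆ (⋃ v ∈ (Finset.univ : Finset V), embBddSet H o G v M) ∪
      ⋃ w ∈ (Finset.univ : Finset W), ⋃ v ∈ Finset.univ.filter (fun v => M < deg G v),
        embBddSet H w G v (deg G v) := by
    rintro f ⟨hinj, hf⟩
    by_cases hM : ∀ w, deg G (f w) ≤ M
    · left
      simp only [Set.mem_iUnion]
      exact ⟨f o, Finset.mem_univ _, hinj, hf, rfl, hM⟩
    · right
      push Not at hM
      obtain ⟨w₀, hw₀⟩ := hM
      obtain ⟨w, -, hw⟩ := Finset.exists_max_image Finset.univ (fun w => deg G (f w))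
        ⟨o, Finset.mem_univ o⟩
      simp only [Set.mem_iUnion]
      refine ⟨w, Finset.mem_univ _, f w, ?_, hinj, hf, rfl, fun x => hw x (Finset.mem_univ _)⟩
      simp only [Finset.mem_filter, Finset.mem_univ, true_and]
      exact hw₀.trans_le (hw w₀ (Finset.mem_univ _))
  have hcard : A.ncard ≤ ∑ v, embBdd H o G v M +
      ∑ w : W, ∑ v ∈ Finset.univ.filter (fun v => M < deg G v), embBdd H w G v (deg G v) := by
    refine (Set.ncard_le_ncard hsub (Set.toFinite _)).trans ((Set.ncard_union_le _ _).trans ?_)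
    refine add_le_add (Finset.set_ncard_biUnion_le _ _) ?_
    refine (Finset.set_ncard_biUnion_le _ _).trans (Finset.sum_le_sum fun w _ => ?_)
    exact Finset.set_ncard_biUnion_le _ _
  have hbound : ∑ w : W, ∑ v ∈ Finset.univ.filter (fun v => M < deg G v),
      embBdd H w G v (deg G v) ≤ Fintype.card W *
        ∑ v ∈ Finset.univ.filter (fun v => M < deg G v), deg G v ^ (Fintype.card W - 1) := by
    rw [← Finset.card_univ, ← smul_eq_mul, ← Finset.sum_const]
    exact Finset.sum_le_sum fun w _ => Finset.sum_le_sum fun v _ =>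
      (embBddSet_finite_and_embBdd_le hH w hfin v _).2
  have h : (emb H G : ℝ) ≤ ((∑ v, embBdd H o G v M + Fintype.card W *
      ∑ v ∈ Finset.univ.filter (fun v => M < deg G v), deg G v ^ (Fintype.card W - 1) : ℕ) : ℝ) := by
    exact_mod_cast hemb.le.trans (hcard.trans (add_le_add_right hbound _))
  refine h.trans (le_of_eq ?_)
  push_cast
  rw [Finset.sum_filter]
  simp only [Set.indicator, Set.mem_ofPred_eq]

end Embeddings

/-! ### Local functions on the space of rooted graphs -/

/-- The number of embeddings of `H` that map `o` to the root and all of whose values have degree at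
most `M`, on the space of rooted graphs. -/
noncomputable def RootedSpace.rootEmbBdd {W : Type} (H : SimpleGraph W) (o : W) (M : ℕ)
    (x : RootedSpace.{u}) : ℕ :=
  Quotient.liftOn x (fun G : RootedGraph.{u} => embBdd H o G.graph G.root M)
    fun _ _ h => embBdd_iso H o h M

theorem continuous_rootDeg_comp (g : ℕ → ℝ) :
    Continuous fun x : RootedSpace.{u} => g x.rootDeg := by
  refine continuous_of_ballAgree 1 fun x y hxy => congrArg g ?_
  induction x using Quotient.inductionOn with
  | h G =>
    induction y using Quotient.inductionOn with
    | h H => exact deg_congr_of_ballIso hxy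

section

variable {W : Type} [Fintype W] {H : SimpleGraph W}

theorem continuous_rootEmbBdd (hH : H.Connected) (o : W) (M : ℕ) :
    Continuous fun x : RootedSpace.{u} => (x.rootEmbBdd H o M : ℝ) := by
  refine continuous_of_ballAgree (Fintype.card W) fun x y hxy => congrArg Nat.cast ?_
  induction x using Quotient.inductionOn with
  | h G =>
    induction y using Quotient.inductionOn with
    | h K => exact embBdd_congr_of_ballIso hH o hxy M

theorem rootEmbBdd_le_pow (hH : H.Connected) (o : W) (M : ℕ) (x : RootedSpace.{u}) :
    x.rootEmbBdd H o M ≤ M ^ (Fintype.card W - 1) := by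
  induction x using Quotient.inductionOn with
  | h G => exact (embBddSet_finite_and_embBdd_le hH o G.locallyFinite G.root M).2

theorem rootEmbBdd_le_rootEmb (hH : H.Connected) (o : W) (M : ℕ) (x : RootedSpace.{u}) :
    x.rootEmbBdd H o M ≤ x.rootEmb H o := by
  induction x using Quotient.inductionOn with
  | h G => exact embBdd_le_embRooted hH o G.locallyFinite G.root M

theorem tendsto_rootEmbBdd (hH : H.Connected) (o : W) (x : RootedSpace.{u}) :
    Tendsto (fun M => (x.rootEmbBdd H o M : ℝ)) atTop (𝓝 (x.rootEmb H o : ℝ)) := by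
  induction x using Quotient.inductionOn with
  | h G =>
    obtain ⟨M₀, hM₀⟩ := embBdd_eq_embRooted hH o G.locallyFinite G.root
    refine tendsto_const_nhds.congr' ?_
    filter_upwards [eventually_ge_atTop M₀] with M hM
    exact congrArg Nat.cast (hM₀ M hM).symm

end

theorem rootEmb_starGraph (k : ℕ) (x : RootedSpace.{u}) :
    x.rootEmb (SimpleGraph.starGraph (0 : Fin (k + 1))) 0 = x.rootDeg.descFactorial k := by
  induction x using Quotient.inductionOn with
  | h G => exact embRooted_starGraph G.root (G.locallyFinite G.root) k

/-! ### From the component of a vertex to the whole graph -/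

theorem ballSet_subset_supp {V : Type u} (G : SimpleGraph V) (v : V) (r : ℕ) :
    ballSet G v r ⊆ (G.connectedComponentMk v).supp := by
  intro x hx
  have h : G.edist v x ≠ ⊤ := ne_top_of_le_ne_top (ENat.natCast_ne_top r) hx
  exact SimpleGraph.ConnectedComponent.sound (SimpleGraph.reachable_of_edist_ne_top h).symm

section Component

variable {V : Type u} [Fintype V] (G : SimpleGraph V) (v : V)

theorem rootDeg_componentAt : (RootedSpace.mk (componentAt G v)).rootDeg = deg G v :=
  deg_induce (S := (G.connectedComponentMk v).supp) ⟨v, rfl⟩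
    ((neighborSet_subset_ballSet (r := 1) (by simp)).trans (ballSet_subset_supp G v 1))

theorem rootEmbBdd_componentAt {W : Type} [Fintype W] {H : SimpleGraph W} (hH : H.Connected)
    (o : W) (M : ℕ) :
    (RootedSpace.mk (componentAt G v)).rootEmbBdd H o M = embBdd H o G v M :=
  embBdd_induce hH o (S := (G.connectedComponentMk v).supp) ⟨v, rfl⟩ (ballSet_subset_supp G v _) M

theorem rootEmb_componentAt {W : Type} [Fintype W] {H : SimpleGraph W} (hH : H.Connected)
    (o : W) : (RootedSpace.mk (componentAt G v)).rootEmb H o = embRooted H o G v := by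
  obtain ⟨M₁, h₁⟩ := embBdd_eq_embRooted hH o (componentAt G v).locallyFinite
    (componentAt G v).root
  obtain ⟨M₂, h₂⟩ := embBdd_eq_embRooted hH o (fun w => (G.neighborSet w).toFinite) v
  exact (h₁ _ (le_max_left M₁ M₂)).symm.trans
    ((rootEmbBdd_componentAt G v hH o _).trans (h₂ _ (le_max_right M₁ M₂)))

theorem expect_rootEmb_componentAt {W : Type} [Fintype W] {H : SimpleGraph W}
    (hH : H.Connected) (o : W) :
    𝔼 v, ((RootedSpace.mk (componentAt G v)).rootEmb H o : ℝ) =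
      (emb H G : ℝ) / (Fintype.card V : ℝ) := by
  simp_rw [rootEmb_componentAt G _ hH]
  rw [Fintype.expect_eq_sum_div_card, emb_eq_sum H o G, Nat.cast_sum]

end Component

/-! ### The equivalences -/

theorem UniformlyIntegrable.of_le_mul_add_one {V : ℕ → Type u} [∀ n, Fintype (V n)]
    {X Y : ∀ n, V n → ℝ} (hY : UniformlyIntegrable Y) (hX0 : ∀ n v, 0 ≤ X n v)
    (hY0 : ∀ n v, 0 ≤ Y n v) {c : ℝ} (hc : 0 < c) (hXY : ∀ n v, X n v ≤ c * (Y n v + 1)) :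
    UniformlyIntegrable X := by
  intro ε hε
  obtain ⟨a₀, ha₀⟩ := hY (ε / (2 * c)) (by positivity)
  -- Beyond this threshold `Y > max a₀ 1 ≥ 1`, so `X ≤ c * (Y + 1) ≤ 2 * c * Y`.
  refine ⟨c * (max a₀ 1 + 1), fun a ha n => ?_⟩
  have h1 := ha₀ (max a₀ 1) (le_max_left _ _) n
  have h2 : Finset.univ.expect ({v | a < |X n v|}.indicator fun v => |X n v|) ≤
      2 * c * Finset.univ.expect ({v | max a₀ 1 < |Y n v|}.indicator fun v => |Y n v|) := by
    rw [Finset.mul_expect]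
    refine Finset.expect_le_expect fun v _ => ?_
    by_cases hv : a < X n v
    · have h3 : c * (max a₀ 1 + 1) < c * (Y n v + 1) := ha.trans_lt (hv.trans_le (hXY n v))
      have h4 : max a₀ 1 < Y n v := by linarith [lt_of_mul_lt_mul_left h3 hc.le]
      have h5 : 1 ≤ Y n v := (le_max_right _ _).trans h4.le
      simp only [Set.indicator, Set.mem_ofPred_eq, abs_of_nonneg (hX0 n v),
        abs_of_nonneg (hY0 n v), hv, h4, if_true]
      nlinarith [hXY n v]
    · simp only [Set.indicator, Set.mem_ofPred_eq, abs_of_nonneg (hX0 n v), hv, if_false,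
        abs_of_nonneg (hY0 n v)]
      split_ifs
      · have := hY0 n v
        positivity
      · simp
  refine h2.trans ((mul_le_mul_of_nonneg_left h1 (by positivity)).trans (le_of_eq ?_))
  field_simp

/-- For `d > k ≥ 1` each factor of the falling factorial is at least `d + 1 - k ≥ d / k`. The added
1 covers `d ≤ k`, where the falling factorial may vanish. -/
theorem pow_le_mul_descFactorial_add_one (d k : ℕ) :
    d ^ k ≤ k ^ k * (d.descFactorial k + 1) := by
  rcases le_or_gt d k with hd | hd
  · exact (Nat.pow_le_pow_left hd k).trans (Nat.le_mul_of_pos_right _ (Nat.succ_pos _))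
  rcases Nat.eq_zero_or_pos k with rfl | hk
  · simp
  · have h1 : d ≤ k * (d + 1 - k) := by
      obtain ⟨m, rfl⟩ := Nat.exists_eq_add_of_lt hd
      rw [show k + m + 1 + 1 - k = m + 2 by omega]
      nlinarith
    calc d ^ k ≤ (k * (d + 1 - k)) ^ k := Nat.pow_le_pow_left h1 k
      _ = k ^ k * (d + 1 - k) ^ k := mul_pow _ _ _
      _ ≤ k ^ k * (d.descFactorial k + 1) :=
        Nat.mul_le_mul_left _ ((d.pow_sub_le_descFactorial k).trans (Nat.le_succ _))

section Equivalences

variable {V : ℕ → Type u} [∀ n, Fintype (V n)] [∀ n, Nonempty (V n)]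
  {G : ∀ n, SimpleGraph (V n)} {μ : ProbabilityMeasure RootedSpace.{u}}

/-- The sample mean of the rooted count is `emb H G / |V|` whichever root is chosen, so the
truncation error may be estimated on unrooted embeddings, where rerooting at a vertex of maximal
image degree is available. -/
theorem LocalWeakLimit.emb_tendsto (hlim : LocalWeakLimit G μ) {W : Type} [Fintype W]
    (hW : 2 ≤ Fintype.card W)
    (hui : UniformlyIntegrable fun n (v : V n) => (deg (G n) v : ℝ) ^ (Fintype.card W - 1))
    {H : SimpleGraph W} (hH : H.Connected) (o : W) :
    Integrable (fun x : RootedSpace.{u} => (x.rootEmb H o : ℝ)) (μ : Measure _) ∧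
      Tendsto (fun n => (emb H (G n) : ℝ) / (Fintype.card (V n) : ℝ)) atTop
        (𝓝 (∫ x, (x.rootEmb H o : ℝ) ∂(μ : Measure RootedSpace.{u}))) := by
  simp_rw [← expect_rootEmb_componentAt _ hH o]
  refine hlim.samplesTendTo.integrable_and_tendsto
    (f := fun x : RootedSpace.{u} => (x.rootEmb H o : ℝ))
    (g := fun M x => (x.rootEmbBdd H o M : ℝ))
    (fun M => continuous_rootEmbBdd hH o M) (fun M => ⟨(M : ℝ) ^ (Fintype.card W - 1), fun x => ?_⟩)
    (fun M x => Nat.cast_nonneg _) (fun M x => by exact_mod_cast rootEmbBdd_le_rootEmb hH o M x)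
    (fun x => tendsto_rootEmbBdd hH o x) fun ε hε => ?_
  · rw [Nat.abs_cast]
    exact_mod_cast rootEmbBdd_le_pow hH o M x
  have hW0 : (0 : ℝ) < Fintype.card W := by
    exact_mod_cast (by omega : 0 < Fintype.card W)
  obtain ⟨a₀, ha₀⟩ := hui (ε / Fintype.card W) (by positivity)
  obtain ⟨M₀, hM₀⟩ := exists_nat_ge a₀
  refine ⟨M₀, fun M hM n => ?_⟩
  have h1 := ha₀ M (hM₀.trans (by exact_mod_cast hM)) n
  have h2 := div_le_div_of_nonneg_right (emb_le_sum_embBdd_add hH o (G n) M)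
    (Nat.cast_nonneg (Fintype.card (V n)) : (0 : ℝ) ≤ _)
  rw [add_div, mul_div_assoc, ← Fintype.expect_eq_sum_div_card,
    ← Fintype.expect_eq_sum_div_card] at h2
  simp_rw [expect_rootEmb_componentAt _ hH o, rootEmbBdd_componentAt _ _ hH o]
  refine h2.trans (add_le_add_right ?_ _)
  rw [← le_div_iff₀' hW0]
  refine le_trans (Finset.expect_le_expect fun v _ => ?_) h1
  by_cases hv : M < deg (G n) v
  · have h3 : (M : ℝ) < (deg (G n) v : ℝ) ^ (Fintype.card W - 1) := by
      exact_mod_cast hv.trans_le (Nat.le_self_pow (by omega) _)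
    have h4 : (0 : ℝ) ≤ (deg (G n) v : ℝ) ^ (Fintype.card W - 1) := by positivity
    simp only [Set.indicator, Set.mem_ofPred_eq, hv, if_true, abs_of_nonneg h4, h3, le_refl]
  · simp only [Set.indicator, Set.mem_ofPred_eq, hv, if_false]
    split_ifs <;> positivity

theorem LocalWeakLimit.uniformlyIntegrable_of_starGraph (hlim : LocalWeakLimit G μ) (k : ℕ)
    (hint : Integrable (fun x : RootedSpace.{u} =>
      (x.rootEmb (SimpleGraph.starGraph (0 : Fin (k + 1))) 0 : ℝ)) (μ : Measure _))
    (hemb : Tendsto (fun n => (emb (SimpleGraph.starGraph (0 : Fin (k + 1))) (G n) : ℝ) /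
      (Fintype.card (V n) : ℝ)) atTop
      (𝓝 (∫ x, (x.rootEmb (SimpleGraph.starGraph (0 : Fin (k + 1))) 0 : ℝ)
        ∂(μ : Measure RootedSpace.{u})))) :
    UniformlyIntegrable fun n (v : V n) => (deg (G n) v : ℝ) ^ k := by
  simp_rw [← expect_rootEmb_componentAt _ (SimpleGraph.connected_starGraph (0 : Fin (k + 1))) 0,
    rootEmb_starGraph] at hint hemb
  have h1 := hlim.samplesTendTo.uniformlyIntegrable_of_tendsto
    (continuous_rootDeg_comp fun d => (d.descFactorial k : ℝ)) (fun x => Nat.cast_nonneg _)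
    hint hemb
  have hk : (0 : ℝ) < (k : ℝ) ^ k := by
    exact_mod_cast Nat.pow_self_pos
  refine h1.of_le_mul_add_one (fun n v => by positivity) (fun n v => Nat.cast_nonneg _) hk
    fun n v => ?_
  rw [rootDeg_componentAt]
  exact_mod_cast pow_le_mul_descFactorial_add_one (deg (G n) v) k

end Equivalences

end LocalWeak

open LocalWeak in
theorem mainTheorem1 (h : ℕ) (hh : 2 ≤ h)
    (V : ℕ → Type u) [∀ n, Fintype (V n)] [∀ n, Nonempty (V n)]
    (G : ∀ n, SimpleGraph (V n))
    (hcard : Tendsto (fun n => Fintype.card (V n)) atTop atTop)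
    (μ : ProbabilityMeasure RootedSpace.{u})
    (hlim : LocalWeakLimit G μ)
    (hmom : Integrable (fun x : RootedSpace.{u} => (x.rootDeg : ℝ) ^ (h - 1)) (μ : Measure _)) :
    List.TFAE
      [ Tendsto (fun n => 𝔼 v, (deg (G n) v : ℝ) ^ (h - 1)) atTop
          (𝓝 (∫ x, (x.rootDeg : ℝ) ^ (h - 1) ∂(μ : Measure RootedSpace.{u}))),
        UniformlyIntegrable (fun n (v : V n) => (deg (G n) v : ℝ) ^ (h - 1)),
        ∀ (H : SimpleGraph (Fin h)), H.Connected → ∀ o : Fin h,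
          Integrable (fun x : RootedSpace.{u} => (x.rootEmb H o : ℝ)) (μ : Measure _) ∧
          Tendsto (fun n => (emb H (G n) : ℝ) / (Fintype.card (V n) : ℝ)) atTop
            (𝓝 (∫ x, (x.rootEmb H o : ℝ) ∂(μ : Measure RootedSpace.{u}))) ] := by
  have hcont : Continuous fun x : RootedSpace.{u} => (x.rootDeg : ℝ) ^ (h - 1) :=
    continuous_rootDeg_comp fun d => (d : ℝ) ^ (h - 1)
  have hnonneg : ∀ x : RootedSpace.{u}, 0 ≤ (x.rootDeg : ℝ) ^ (h - 1) := fun x => by positivity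
  tfae_have 1 → 2 := by
    intro h1
    have h2 := hlim.samplesTendTo.uniformlyIntegrable_of_tendsto hcont hnonneg hmom
      (by simpa only [rootDeg_componentAt] using h1)
    simpa only [rootDeg_componentAt] using h2
  tfae_have 2 → 1 := by
    intro h2
    have h1 := hlim.samplesTendTo.tendsto_of_uniformlyIntegrable hcont hnonneg
      (by simpa only [rootDeg_componentAt] using h2)
    simpa only [rootDeg_componentAt] using h1
  tfae_have 2 → 3 := by
    intro h2 H hH o
    exact hlim.emb_tendsto (by simpa using hh) (by simpa using h2) hH o
  tfae_have 3 → 2 := by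
    intro h3
    obtain ⟨k, rfl⟩ : ∃ k, h = k + 1 := ⟨h - 1, by omega⟩
    -- Only the star on `h` vertices, rooted at its centre, is needed from (iii).
    obtain ⟨hint, hemb⟩ := h3 _ (SimpleGraph.connected_starGraph 0) 0
    exact hlim.uniformlyIntegrable_of_starGraph k hint hemb
  tfae_finish
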